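/- Let $K\subset S^3$ be a tame link with components $K_1,\dots,K_c$, let $V_1,\dots,V_c$ be open tubular neighbourhoods of $K_1,\dots,K_c$ with pairwise disjoint closures (each $V_i$ is an open solid torus with core $K_i$, tamely embedded up to its boundary), and let $X=S^3\setminus\bigcup_i V_i$ be the closed link complement. Let $G_K=\pi_1(X,x)$ be the link group, where $x\in X$. Suppose that $K$ is peripherally nontrivial, i.e. for every $i$ the peripheral subgroup, the image of $\pi_1(\partial V_i,t)\to\pi_1(X,t)$ with $t\in\partial V_i$, is isomorphic to $\mathbb{Z}^2$. Let $U\trianglelefteq G_K$ be a normal subgroup of finite index and let $\pi^U\colon X_U\to X$ be the finite covering induced by $U$, i.e. the path-connected covering with $\pi^U_*\pi_1(X_U,\tilde x)=U$ for some $\tilde x$ over $x$ (the quotient by $U$ of the universal covering of $X$; if $X$ is aspherical, this is $EG_K/U\to BG_K$). Then $U=G_K$ if and only if for every $i=1,\dots,c$ $$|\pi_0((\pi^U)^{-1}(\partial V_i))|=|G_K:U|.$$ -/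

import Mathlib

/-- The `3`-sphere, as the unit sphere of `ℝ⁴`. -/
abbrev S3 : Type := Metric.sphere (0 : EuclideanSpace ℝ (Fin 4)) 1

/-- `V` is a (tame, open) tubular neighbourhood of the knot `K ⊆ S³`: an open solid torus with core
`K` whose parametrisation extends to a slightly larger open solid torus. Here `φ` parametrises the
larger solid torus by `S¹ × ℂ`, its core `S¹ × {0}` goes onto `K` and the open unit disc bundle goes
onto `V`. In particular `K` is a tame knot and the boundary of `V` is a bicollared torus. -/
def IsTubularNeighbourhood (K V : Set S3) : Prop :=
  ∃ φ : Circle × ℂ → S3, Topology.IsOpenEmbedding φ ∧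
    φ '' (Set.univ ×ˢ {0}) = K ∧ φ '' (Set.univ ×ˢ Metric.ball 0 1) = V

/-- `K` is the family of components of a tame link in `S³` and `V` is a family of
tubular neighbourhoods of these components, pairwise separated (their closures are disjoint). -/
structure IsLinkWithTubes {c : ℕ} (K V : Fin c → Set S3) : Prop where
  tubular : ∀ i, IsTubularNeighbourhood (K i) (V i)
  separated : ∀ i j, i ≠ j → Disjoint (closure (V i)) (closure (V j))

/-- The closed link complement `X = S³ ∖ ⋃ Vᵢ`, a compact `3`-manifold with boundary `⋃ ∂Vᵢ`. -/
abbrev LinkExterior {c : ℕ} (V : Fin c → Set S3) : Type :=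
  ((⋃ i, V i)ᶜ : Set S3)

/-- The boundary torus `∂Vᵢ`, as a subset of the closed link complement. -/
def boundaryTorus {c : ℕ} (V : Fin c → Set S3) (i : Fin c) : Set (LinkExterior V) :=
  {z | (z : S3) ∈ frontier (V i)}

/-- The link group `π₁(X, x)`, computed in the closed link complement `X`. -/
abbrev LinkGroup {c : ℕ} (V : Fin c → Set S3) (x : LinkExterior V) : Type :=
  FundamentalGroup (LinkExterior V) x

/-- The peripheral subgroup of the `i`-th component with base point `t ∈ ∂Vᵢ`: the image of
`π₁(∂Vᵢ, t) → π₁(X, t)`. -/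
noncomputable def peripheralSubgroup {c : ℕ} (V : Fin c → Set S3) (i : Fin c)
    (t : boundaryTorus V i) : Subgroup (LinkGroup V t) :=
  (FundamentalGroup.map
    (⟨Subtype.val, continuous_subtype_val⟩ : C(boundaryTorus V i, LinkExterior V)) t).range

/-- The link is peripherally nontrivial: all its peripheral subgroups are isomorphic to `ℤ²`. -/
def IsPeripherallyNontrivial {c : ℕ} (V : Fin c → Set S3) : Prop :=
  ∀ (i : Fin c) (t : boundaryTorus V i),
    Nonempty (peripheralSubgroup V i t ≃* Multiplicative (ℤ × ℤ))

/-- `p : Y → X` is the (connected) covering induced by the subgroup `U` of `π₁(X, x)`, i.e. the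
quotient by `U` of the universal covering of `X`: it is characterised by
`p_* π₁(Y, y) = U` for some base point `y` above `x`. -/
def IsCoveringInducedBy {X Y : Type*} [TopologicalSpace X] [TopologicalSpace Y] {x : X}
    (U : Subgroup (FundamentalGroup X x)) (p : C(Y, X)) : Prop :=
  PathConnectedSpace Y ∧ IsCoveringMap p ∧
    ∃ (y : Y) (h : p y = x), (FundamentalGroup.mapOfEq p h).range = U

/-! Let n be the index of U, which is the number of sheets. If n = 1, then p is a homeomorphism and
the preimage of each torus is connected.

Conversely, path lifting shows that every component of the preimage of ∂Vᵢ meets every fibre. If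
there are n components, each meets every fibre exactly once, so p is a product over ∂Vᵢ, with
sections labelled by the components. The covering therefore extends over the solid tubes: S³ ∖ K
retracts onto X, and the pullback of p along this retraction is glued to a product bundle over each
Vᵢ. The result is a covering of S³, which is simply connected, so it has a section through every
point. Restricted to X, these give sections of p through every point of Y. Since Y is connected, a
section s satisfies s ∘ p = id, so p is injective and n = 1.

The main steps are `exists_sections_of_natCard_zerothHomotopy` (triviality over the tori),
`exists_retraction`, `SectionAtlas.core` (gluing) and `exists_section_sphere`. -/

open Topology Set Metric

/-! ### Sheets, monodromy and sections of coverings -/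

namespace IsCoveringMap

variable {E X : Type*} [TopologicalSpace E] [TopologicalSpace X] {p : E → X}

/-- Two points of the base joined by a path have fibres of the same cardinality. -/
theorem natCard_fiber_eq [PathConnectedSpace X] (cov : IsCoveringMap p) (x y : X) :
    Nat.card (p ⁻¹' {x}) = Nat.card (p ⁻¹' {y}) :=
  Nat.card_eq_of_bijective _
    (cov.monodromy_bijective (Path.Homotopic.Quotient.mk (PathConnectedSpace.somePath x y)))

/-- The number of sheets of a path connected covering is the index of the subgroup of the
fundamental group that it induces. -/
theorem natCard_fiber_eq_index [PathConnectedSpace E] (p : C(E, X)) (cov : IsCoveringMap p)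
    {x : X} {y : E} (h : p y = x) :
    Nat.card (p ⁻¹' {x}) = (FundamentalGroup.mapOfEq p h).range.index := by
  let _ := cov.fundamentalGroupMulAction x
  have hsmul (γ : FundamentalGroup X x) (e : p ⁻¹' {x}) : γ • e = cov.monodromy γ e := rfl
  have trans : MulAction.IsPretransitive (FundamentalGroup X x) (p ⁻¹' {x}) := by
    refine ⟨fun e e' ↦ ?_⟩
    obtain ⟨Γ⟩ : Nonempty (Path.Homotopic.Quotient e.1 e'.1) :=
      ⟨.mk (PathConnectedSpace.somePath e.1 e'.1)⟩
    refine ⟨(Γ.map p).cast (Eq.symm e.2) (Eq.symm e'.2), ?_⟩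
    rw [hsmul]
    exact cov.monodromy_eq_of_map_eq Γ (by
      obtain ⟨γ⟩ := Γ
      rfl)
  -- A loop fixes y exactly when its lift at y closes up, i.e. when it is the image of a loop in E.
  have stab : MulAction.stabilizer (FundamentalGroup X x) (⟨y, h⟩ : p ⁻¹' {x}) =
      (FundamentalGroup.mapOfEq p h).range := by
    ext γ
    rw [MulAction.mem_stabilizer_iff, hsmul, MonoidHom.mem_range]
    constructor
    · intro hγ
      -- The endpoint of the lift is a variable z so that it can be substituted by y in the type of
      -- the lifted path.
      have key (z : p ⁻¹' {x}) (hz : z = ⟨y, h⟩) (Γ : Path.Homotopic.Quotient y z.1)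
          (hΓ : Γ.map p = Path.Homotopic.Quotient.cast γ h z.2) : ∃ Γ', FundamentalGroup.mapOfEq p h Γ' = γ := by
        subst hz
        refine ⟨Γ, ?_⟩
        rw [FundamentalGroup.mapOfEq_apply]
        refine (congrArg (fun δ ↦ Path.Homotopic.Quotient.cast δ h.symm h.symm) hΓ).trans ?_
        obtain ⟨γ⟩ := γ
        rfl
      exact key _ hγ _ (cov.map_liftPathQuotient γ ⟨y, h⟩)
    · rintro ⟨Γ, rfl⟩
      rw [FundamentalGroup.mapOfEq_apply]
      exact cov.monodromy_eq_of_map_eq (ex := ⟨y, h⟩) (ey := ⟨y, h⟩) Γ (by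
        obtain ⟨γ⟩ := Γ
        rfl)
  rw [← stab, MulAction.index_stabilizer_of_transitive]

/-- Two points in the same fibre of a covering coincide if a global continuous section passes
through the first and a path in the total space joins them. -/
theorem injective_of_exists_section [PathConnectedSpace E] (cov : IsCoveringMap p)
    (hs : ∀ e, ∃ s : X → E, Continuous s ∧ (∀ x, p (s x) = x) ∧ s (p e) = e) :
    Function.Injective p := by
  intro e e' h
  obtain ⟨s, hs, hps, he⟩ := hs e
  -- Both s ∘ p and the identity lift p and they agree at e, so they agree on the connected space E.
  have := cov.eq_of_comp_eq (g₁ := fun t : E ↦ s (p t)) (g₂ := id)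
    (hs.comp cov.continuous) continuous_id (funext fun t ↦ hps _) e he
  calc e = s (p e) := he.symm
    _ = s (p e') := by rw [h]
    _ = e' := congr_fun this e'

/-- If a covering of a path connected, locally path connected space has as many path components as
sheets, then it is a product: through each point passes exactly one of finitely many sections,
indexed by the path components. -/
theorem exists_sections_of_natCard_zerothHomotopy [PathConnectedSpace X]
    [LocallyPathConnectedSpace X] (cov : IsCoveringMap p) {n : ℕ} (hn : n ≠ 0)
    (hfib : ∀ x, Nat.card (p ⁻¹' {x}) = n) (hcomp : Nat.card (ZerothHomotopy E) = n) :
    ∃ s : ZerothHomotopy E → X → E, (∀ C, Continuous (s C)) ∧ (∀ C x, p (s C x) = x) ∧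
      ∀ e, ∃! C, s C (p e) = e := by
  have fin (x : X) : Finite (p ⁻¹' {x}) := Nat.finite_of_card_ne_zero (by rw [hfib]; exact hn)
  have fin' : Finite (ZerothHomotopy E) := Nat.finite_of_card_ne_zero (by rw [hcomp]; exact hn)
  -- Path lifting makes every component meet the fibre; equal finite cardinalities turn this
  -- surjection into a bijection.
  have bij (x : X) : Function.Bijective
      (fun e : p ⁻¹' {x} ↦ (ZerothHomotopy.mk e.1 : ZerothHomotopy E)) := by
    have := Fintype.ofFinite (p ⁻¹' {x})
    have := Fintype.ofFinite (ZerothHomotopy E)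
    rw [Fintype.bijective_iff_surjective_and_card]
    refine ⟨fun C ↦ ?_, by rw [← Nat.card_eq_fintype_card, ← Nat.card_eq_fintype_card, hfib, hcomp]⟩
    induction C with
    | mk e =>
      let γ := PathConnectedSpace.somePath (p e) x
      refine ⟨⟨cov.liftPath γ e γ.source 1, ?_⟩, ?_⟩
      · exact (congr_fun (cov.liftPath_lifts γ e γ.source) 1).trans γ.target
      · exact ZerothHomotopy.sound (Path.symm
          ⟨cov.liftPath γ e γ.source, cov.liftPath_zero γ e γ.source, rfl⟩)
  choose s hsC using fun C x ↦ (bij x).2 C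
  dsimp only at hsC
  have hps (C x) : p (s C x) = x := (s C x).2
  have huniq {e e' : E} (h : p e = p e')
      (h' : (ZerothHomotopy.mk e : ZerothHomotopy E) = .mk e') : e = e' :=
    congrArg Subtype.val ((bij (p e')).1 (a₁ := ⟨e, h⟩) (a₂ := ⟨e', rfl⟩) h')
  refine ⟨fun C x ↦ s C x, fun C ↦ ?_, hps, fun e ↦ ?_⟩
  · rw [continuous_iff_continuousAt]
    intro x
    -- Near x the section is the local inverse of p: over a path connected neighbourhood that
    -- inverse stays in the component C, which meets each fibre once.
    obtain ⟨φ, hφ, hφp⟩ := cov.isLocalHomeomorph (s C x)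
    have hx : x ∈ φ.target := by
      have := φ.map_source hφ
      rwa [← hφp, hps] at this
    have hsx : φ.symm x = s C x := by
      rw [← φ.left_inv hφ, ← hφp, hps]
    obtain ⟨N, ⟨hN, hNp⟩, hNt⟩ := (path_connected_basis x).mem_iff.1 (φ.open_target.mem_nhds hx)
    refine (φ.continuousAt_symm hx).congr ?_
    filter_upwards [hN] with x' hx'
    have hj := (hNp.joinedIn x (mem_of_mem_nhds hN) x' hx').map_continuousOn
      (φ.continuousOn_symm.mono hNt)
    refine huniq ?_ ?_
    · rw [hps, hφp]; exact φ.right_inv (hNt hx')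
    · rw [hsC]
      refine Eq.trans (Eq.symm ?_) (hsC C x)
      rw [← hsx]
      exact ZerothHomotopy.sound hj.joined.somePath
  · refine ⟨.mk e, huniq (hps _ _) (hsC _ _), fun C hC ↦ ?_⟩
    exact (hsC C (p e)).symm.trans (congrArg ZerothHomotopy.mk hC)

/-- Every point of the base of an `n`-sheeted covering has an open neighbourhood over which the
covering is a product. -/
theorem exists_local_sections (cov : IsCoveringMap p) {n : ℕ} (hn : n ≠ 0) (x : X)
    (hfib : Nat.card (p ⁻¹' {x}) = n) :
    ∃ (D : Set X) (s : Fin n → X → E), IsOpen D ∧ x ∈ D ∧ (∀ f, ContinuousOn (s f) D) ∧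
      (∀ f, ∀ b ∈ D, p (s f b) = b) ∧ ∀ e, p e ∈ D → ∃! f, s f (p e) = e := by
  have : Nonempty (p ⁻¹' {x}) := (Nat.card_ne_zero.1 (by rw [hfib]; exact hn)).1
  have : Finite (p ⁻¹' {x}) := Nat.finite_of_card_ne_zero (by rw [hfib]; exact hn)
  let c : Fin n ≃ p ⁻¹' {x} := (Finite.equivFinOfCardEq hfib).symm
  let t := (cov x).toTrivialization
  refine ⟨t.baseSet, fun f b ↦ t.toOpenPartialHomeomorph.symm (b, c f), t.open_baseSet,
    (cov x).mem_toTrivialization_baseSet, fun f ↦ ?_, fun f b hb ↦ ?_, fun e he ↦ ?_⟩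
  · exact t.toOpenPartialHomeomorph.continuousOn_symm.comp (by fun_prop)
      fun b hb ↦ t.mem_target.2 hb
  · exact t.proj_symm_apply' hb
  · have hes : e ∈ t.source := t.mem_source.2 he
    refine ⟨c.symm (t e).2, ?_, fun f hf ↦ ?_⟩
    · simp only [Equiv.apply_symm_apply]
      rw [t.symm_apply_mk_proj hes]
    · rw [← hf, t.apply_symm_apply' he, Equiv.symm_apply_apply]

end IsCoveringMap

/-! ### Coverings of the 3-sphere -/

section Sphere

variable {E : Type*} [TopologicalSpace E] {p : E → S3}

/-- A covering of the `3`-sphere has a continuous section on the complement of a point. -/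
theorem IsCoveringMap.exists_section_compl_singleton (cov : IsCoveringMap p) (v : S3) (e : E)
    (he : p e ≠ v) :
    ∃ s : S3 → E, ContinuousOn s {v}ᶜ ∧ (∀ b ∈ ({v}ᶜ : Set S3), p (s b) = b) ∧ s (p e) = e := by
  have : Fact (Module.finrank ℝ (EuclideanSpace ℝ (Fin 4)) = 3 + 1) := ⟨by simp⟩
  let φ := stereographic' 3 v
  have hsrc : φ.source = {v}ᶜ := stereographic'_source v
  have htgt : φ.target = univ := stereographic'_target v
  have hcont : Continuous φ.symm := by
    rw [← continuousOn_univ, ← htgt]; exact φ.continuousOn_symm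
  have hpe : p e ∈ φ.source := by rw [hsrc]; exact he
  -- The inverse stereographic projection lifts because ℝ³ is simply connected.
  obtain ⟨F, ⟨hFe, hF⟩, -⟩ := cov.existsUnique_continuousMap_lifts ⟨φ.symm, hcont⟩ (φ (p e)) e
    (φ.left_inv hpe).symm
  refine ⟨fun b ↦ F (φ b), F.continuous.comp_continuousOn (hsrc ▸ φ.continuousOn), fun b hb ↦ ?_,
    hFe⟩
  exact (congr_fun hF (φ b)).trans (φ.left_inv (hsrc ▸ hb))

/-- Stereographic projection identifies this set with ℝ³ minus a point. Its connectedness makes two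
sections over the charts agree on the whole overlap once they agree at one point. -/
theorem isConnected_compl_pair_antipodal (v : S3) :
    IsConnected ({v}ᶜ ∩ {-v}ᶜ : Set S3) := by
  have hfact : Fact (Module.finrank ℝ (EuclideanSpace ℝ (Fin 4)) = 3 + 1) := ⟨by simp⟩
  let φ := stereographic' 3 v
  have hsrc : φ.source = {v}ᶜ := stereographic'_source v
  have htgt : φ.target = univ := stereographic'_target v
  have hcont : Continuous φ.symm := by
    rw [← continuousOn_univ, ← htgt]; exact φ.continuousOn_symm
  have hv : -v ∈ φ.source := by
    rw [hsrc]
    intro h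
    exact ne_neg_of_mem_unit_sphere ℝ v h.symm
  have himg : φ.symm '' {φ (-v)}ᶜ = {v}ᶜ ∩ {-v}ᶜ := by
    ext b
    constructor
    · rintro ⟨w, hw, rfl⟩
      have hwt : w ∈ φ.target := htgt ▸ mem_univ w
      refine ⟨hsrc ▸ φ.map_target hwt, fun h ↦ hw ?_⟩
      have h' : φ.symm w = -v := h
      rw [mem_singleton_iff, ← h', φ.right_inv hwt]
    · rintro ⟨hb, hb'⟩
      refine ⟨φ b, fun h ↦ hb' ?_, φ.left_inv (hsrc ▸ hb)⟩
      exact φ.injOn (hsrc ▸ hb) hv h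
  rw [← himg]
  refine IsConnected.image (isPathConnected_compl_singleton_of_one_lt_rank ?_ _).isConnected _
    hcont.continuousOn
  rw [← Module.finrank_eq_rank]
  simp

/-- A covering of the `3`-sphere has a global continuous section through every point. -/
theorem IsCoveringMap.exists_section_sphere (cov : IsCoveringMap p) (e : E) :
    ∃ s : S3 → E, Continuous s ∧ (∀ b, p (s b) = b) ∧ s (p e) = e := by
  classical
  set v : S3 := -(p e) with hv
  have hpv : p e ≠ v := fun h ↦
    ne_neg_of_mem_unit_sphere ℝ (p e) h
  obtain ⟨s, hs, hps, hse⟩ := cov.exists_section_compl_singleton v e hpv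
  have hconn := isConnected_compl_pair_antipodal v
  obtain ⟨q, hqv, hqv'⟩ := hconn.nonempty
  obtain ⟨s', hs', hps', hse'⟩ := cov.exists_section_compl_singleton (-v) (s q)
    (by rw [hps q hqv]; exact hqv')
  rw [hps q hqv] at hse'
  have hagree : EqOn s s' ({v}ᶜ ∩ {-v}ᶜ) :=
    cov.eqOn_of_comp_eqOn hconn.isPreconnected (hs.mono inter_subset_left)
      (hs'.mono inter_subset_right)
      (fun b hb ↦ (hps b hb.1).trans (hps' b hb.2).symm) ⟨hqv, hqv'⟩ hse'.symm
  have hne : v ≠ -v := fun h ↦ ne_neg_of_mem_unit_sphere ℝ v h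
  -- The section s is uncontrolled only at v, so s' is used there and nowhere else.
  refine ⟨fun b ↦ if b = v then s' b else s b, ?_, fun b ↦ ?_, by simp [hpv, hse]⟩
  · rw [continuous_iff_continuousAt]
    intro b
    by_cases hb : b = v
    · have hb' : b ∈ ({-v}ᶜ : Set S3) := by rw [hb]; exact hne
      refine (hs'.continuousAt (isOpen_compl_singleton.mem_nhds hb')).congr ?_
      filter_upwards [isOpen_compl_singleton.mem_nhds hb'] with b' hb'
      by_cases h : b' = v
      · simp [h]
      · simp only [h, if_false]; exact (hagree ⟨h, hb'⟩).symm
    · refine (hs.continuousAt (isOpen_compl_singleton.mem_nhds hb)).congr ?_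
      filter_upwards [isOpen_compl_singleton.mem_nhds hb] with b' hb'
      have : b' ≠ v := hb'
      simp [this]
  · by_cases hb : b = v
    · simp only [hb, if_true]; exact hps' v hne
    · simp only [hb, if_false]; exact hps b hb

end Sphere

/-! ### Gluing a pulled-back covering to product bundles -/

section Gluing

/-- A family of `F`-indexed local sections of `p : Y → X` over sets `D j`, with open sets `A j`
of `S` covering `S` and a map `ρ : S → X`, such that `ρ` maps `A j ∩ W` into `D j` and distinct
`A j`, `A k` meet only inside `W`. -/
structure SectionAtlas {Y X S : Type*} [TopologicalSpace Y] [TopologicalSpace X]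
    [TopologicalSpace S] (p : Y → X) (ρ : S → X) (W : Set S) (F ι : Type*) where
  D : ι → Set X
  sec : ι → F → X → Y
  A : ι → Set S
  at' : S → ι
  mem_at : ∀ b, b ∈ A (at' b)
  isOpen_A : ∀ j, IsOpen (A j)
  continuousOn_ρ : ContinuousOn ρ W
  continuousOn_sec : ∀ j f, ContinuousOn (sec j f) (D j)
  proj_sec : ∀ j f, ∀ x ∈ D j, p (sec j f x) = x
  existsUnique : ∀ j y, p y ∈ D j → ∃! f, sec j f (p y) = y
  mapsTo : ∀ j, ∀ b ∈ A j ∩ W, ρ b ∈ D j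
  -- Off W the transition maps below are set to the identity; this condition keeps that switch away
  -- from overlaps of distinct charts.
  inter_subset : ∀ j k, j ≠ k → A j ∩ A k ⊆ W

namespace SectionAtlas

variable {Y X S : Type*} [TopologicalSpace Y] [TopologicalSpace X]
    [TopologicalSpace S] {p : Y → X} {ρ : S → X} {W : Set S} {F ι : Type*}
    (T : SectionAtlas p ρ W F ι)

open Classical in
/-- The index of the section of the `k`-th family through a point. -/
noncomputable def coord [Nonempty F] (k : ι) (y : Y) : F :=
  if h : p y ∈ T.D k then (T.existsUnique k y h).choose else Classical.arbitrary F

theorem sec_coord [Nonempty F] {k : ι} {y : Y} (h : p y ∈ T.D k) :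
    T.sec k (T.coord k y) (p y) = y := by
  rw [coord, dif_pos h]
  exact (T.existsUnique k y h).choose_spec.1

theorem coord_sec [Nonempty F] {k : ι} {x : X} (h : x ∈ T.D k) (f : F) :
    T.coord k (T.sec k f x) = f := by
  have hp := T.proj_sec k f x h
  have h' : p (T.sec k f x) ∈ T.D k := by rwa [hp]
  refine (T.existsUnique k _ h').unique (T.sec_coord h') ?_
  rw [hp]

open Classical in
/-- The fibre bundle over `S` obtained by gluing the pullback of `p` along `ρ` over `W` with the
product bundles over the sets `A j`. -/
noncomputable def core [Nonempty F] [TopologicalSpace F] [DiscreteTopology F]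
    (cov : IsCoveringMap p) : FiberBundleCore ι S F where
  baseSet := T.A
  isOpen_baseSet := T.isOpen_A
  indexAt := T.at'
  mem_baseSet_at := T.mem_at
  coordChange j k b f := if b ∈ W then T.coord k (T.sec j f (ρ b)) else f
  coordChange_self j b hb f := by
    split_ifs with hW
    · exact T.coord_sec (T.mapsTo j b ⟨hb, hW⟩) f
    · rfl
  coordChange_comp i j k b hb f := by
    split_ifs with hW
    · have hj := T.mapsTo j b ⟨hb.1.2, hW⟩
      have hi := T.mapsTo i b ⟨hb.1.1, hW⟩
      have := T.sec_coord (k := j) (y := T.sec i f (ρ b)) (by rwa [T.proj_sec i f _ hi])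
      rw [T.proj_sec i f _ hi] at this
      rw [this]
    · rfl
  continuousOn_coordChange j k := by
    by_cases hjk : j = k
    · subst hjk
      refine continuousOn_snd.congr ?_
      rintro ⟨b, f⟩ ⟨⟨hb, -⟩, -⟩
      dsimp only
      split_ifs with hW
      · exact T.coord_sec (T.mapsTo j b ⟨hb, hW⟩) f
      · rfl
    · rintro ⟨b, f⟩ ⟨hb, -⟩
      set N := T.A j ∩ T.A k with hN
      have hNW : N ⊆ W := T.inter_subset j k hjk
      have hNo : IsOpen N := (T.isOpen_A j).inter (T.isOpen_A k)
      have hsec (l : ι) (hl : N ⊆ T.A l) (g : F) : ContinuousOn (fun b ↦ T.sec l g (ρ b)) N :=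
        (T.continuousOn_sec l g).comp (T.continuousOn_ρ.mono hNW)
          fun b hb ↦ T.mapsTo l b ⟨hl hb, hNW hb⟩
      have hj := hsec j inter_subset_left f
      have hDj (b' : S) (hb' : b' ∈ N) : ρ b' ∈ T.D j := T.mapsTo j b' ⟨hb'.1, hNW hb'⟩
      have hDk (b' : S) (hb' : b' ∈ N) : ρ b' ∈ T.D k := T.mapsTo k b' ⟨hb'.2, hNW hb'⟩
      set g := T.coord k (T.sec j f (ρ b)) with hg
      have hk := hsec k inter_subset_right g
      -- Two continuous lifts agree on an open set since p is locally injective; hence the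
      -- k-coordinate of a j-section is locally constant.
      have hopen : IsOpen {b' : N | T.sec j f (ρ b') = T.sec k g (ρ b')} := by
        refine cov.isLocalHomeomorph.isLocallyInjective.isOpen_eqLocus
          (continuousOn_iff_continuous_domRestrict.1 hj) (continuousOn_iff_continuous_domRestrict.1 hk)
          (funext fun b' ↦ ?_)
        exact (T.proj_sec j f _ (hDj b' b'.2)).trans (T.proj_sec k g _ (hDk b' b'.2)).symm
      have heq : T.sec j f (ρ b) = T.sec k g (ρ b) := by
        have hp := T.proj_sec j f _ (hDj b hb)
        have := T.sec_coord (k := k) (y := T.sec j f (ρ b)) (by rw [hp]; exact hDk b hb)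
        rw [hp] at this
        exact this.symm
      have hev : ∀ᶠ b' in 𝓝 b, b' ∈ N ∧ T.sec j f (ρ b') = T.sec k g (ρ b') := by
        have := (hNo.isOpenMap_subtype_val _ hopen).mem_nhds
          (show b ∈ Subtype.val '' _ from ⟨⟨b, hb⟩, heq, rfl⟩)
        filter_upwards [this]
        rintro _ ⟨b', hb', rfl⟩
        exact ⟨b'.2, hb'⟩
      refine ContinuousAt.continuousWithinAt ?_
      refine (continuousAt_const (y := g)).congr ?_
      rw [nhds_prod_eq, nhds_discrete F]
      filter_upwards [Filter.prod_mem_prod hev (Filter.mem_pure.2 rfl : {f} ∈ pure f)]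
      rintro ⟨b', f'⟩ ⟨⟨hb', hb''⟩, hf'⟩
      obtain rfl : f' = f := hf'
      simp only [hNW hb', if_true]
      rw [hb'', T.coord_sec (hDk b' hb')]

/-- If every covering glued from the atlas has global sections, then so has `p`. -/
theorem exists_section [Nonempty F] [TopologicalSpace F] [DiscreteTopology F]
    (cov : IsCoveringMap p)
    (hS : ∀ e : (T.core cov).TotalSpace, ∃ s : S → (T.core cov).TotalSpace,
      Continuous s ∧ (∀ b, (s b).proj = b) ∧ s e.proj = e)
    {i : X → S} (hi : Continuous i) (hρi : ∀ x, ρ (i x) = x) (hiW : ∀ x, i x ∈ W) (y : Y) :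
    ∃ s : X → Y, Continuous s ∧ (∀ x, p (s x) = x) ∧ s (p y) = y := by
  have hD (j : ι) (x : X) (hx : i x ∈ T.A j) : x ∈ T.D j := by
    have := T.mapsTo j (i x) ⟨hx, hiW x⟩
    rwa [hρi] at this
  obtain ⟨s, hs, hps, hse⟩ := hS ⟨i (p y), T.coord (T.at' (i (p y))) y⟩
  -- The coordinate of s in a fixed chart j is locally constant near points of that chart, whereas
  -- the preferred index `at' (i x)` may jump with x.
  let c (j : ι) (x : X) : F := (T.core cov).coordChange (T.at' (i x)) j (i x)
    ((s (i x)).2 : F)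
  have hc (j : ι) (x : X) (hx : i x ∈ T.A j) :
      T.sec j (c j x) x = T.sec (T.at' (i x)) ((s (i x)).2 : F) x := by
    have h1 := hD _ x (T.mem_at (i x))
    have hp := T.proj_sec (T.at' (i x)) ((s (i x)).2 : F) x h1
    have h2 := T.sec_coord (k := j) (y := T.sec (T.at' (i x)) ((s (i x)).2 : F) x)
      (by rw [hp]; exact hD j x hx)
    rw [hp] at h2
    simp only [c, core, hiW x, hρi]
    exact h2
  refine ⟨fun x ↦ T.sec (T.at' (i x)) ((s (i x)).2 : F) x, ?_, fun x ↦ ?_, ?_⟩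
  · rw [continuous_iff_continuousAt]
    intro x
    set j := T.at' (i x) with hj
    have hA : i ⁻¹' T.A j ∈ 𝓝 x :=
      ((T.isOpen_A j).preimage hi).mem_nhds (T.mem_at (i x))
    have hcc : ContinuousAt (c j) x := by
      have h1 : ContinuousAt (fun x ↦ ((T.core cov).localTriv j (s (i x))).2) x := by
        refine continuous_snd.continuousAt.comp (ContinuousAt.comp
          (((T.core cov).localTriv j).continuousAt ?_) (hs.comp hi).continuousAt)
        rw [Bundle.Trivialization.mem_source]
        change (s (i x)).proj ∈ T.A j
        rw [hps]
        exact T.mem_at (i x)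
      refine h1.congr (Filter.Eventually.of_forall fun x' ↦ ?_)
      change (T.core cov).coordChange (T.at' (s (i x')).proj) j (s (i x')).proj _ = _
      rw [hps]
    have hev : ∀ᶠ x' in 𝓝 x, c j x' = c j x :=
      hcc.eventually_mem (by rw [nhds_discrete]; exact Filter.mem_pure.2 rfl : {c j x} ∈ 𝓝 (c j x))
    have hDn : T.D j ∈ 𝓝 x := Filter.mem_of_superset hA fun x' hx' ↦ hD j x' hx'
    refine ((T.continuousOn_sec j (c j x)).continuousAt hDn).congr ?_
    filter_upwards [hev, hA] with x' hx' hx'A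
    rw [← hx', hc j x' hx'A]
  · exact T.proj_sec _ _ x (hD _ x (T.mem_at (i x)))
  · have h := hD _ (p y) (T.mem_at (i (p y)))
    dsimp only at hse ⊢
    rw [hse]
    exact T.sec_coord h

end SectionAtlas

end Gluing

/-! ### Solid tubes and radial projection -/

section Tube

variable {φ : Circle × ℂ → S3}

theorem closure_image_univ_prod_ball (hφ : IsOpenEmbedding φ) :
    closure (φ '' (univ ×ˢ ball 0 1)) = φ '' (univ ×ˢ closedBall 0 1) := by
  apply Subset.antisymm
  · refine closure_minimal (image_mono (prod_mono_right ball_subset_closedBall)) ?_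
    exact ((isCompact_univ.prod (isCompact_closedBall 0 1)).image hφ.continuous).isClosed
  · have := image_closure_subset_closure_image hφ.continuous (s := univ ×ˢ ball (0 : ℂ) 1)
    rwa [closure_prod_eq, closure_univ, closure_ball _ one_ne_zero] at this

theorem isOpen_image_univ_prod_ball (hφ : IsOpenEmbedding φ) :
    IsOpen (φ '' (univ ×ˢ ball 0 1)) :=
  hφ.isOpenMap _ (isOpen_univ.prod isOpen_ball)

theorem frontier_image_univ_prod_ball (hφ : IsOpenEmbedding φ) :
    frontier (φ '' (univ ×ˢ ball 0 1)) = φ '' (univ ×ˢ sphere 0 1) := by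
  rw [(isOpen_image_univ_prod_ball hφ).frontier_eq, closure_image_univ_prod_ball hφ,
    ← image_sdiff hφ.injective]
  congr 1
  ext ⟨a, z⟩
  simp [le_antisymm_iff]

end Tube

/-- The fibrewise radial projection of `S¹ × ℂ` to `S¹ × S¹`, extended arbitrarily to the core. -/
noncomputable def radialProjection (w : Circle × ℂ) : Circle × ℂ :=
  (w.1, if w.2 = 0 then 1 else ‖w.2‖⁻¹ • w.2)

theorem norm_radialProjection_snd (w : Circle × ℂ) : ‖(radialProjection w).2‖ = 1 := by
  unfold radialProjection
  split_ifs with h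
  · simp
  · simp [inv_mul_cancel₀ (norm_ne_zero_iff.2 h)]

theorem radialProjection_of_norm_eq_one {w : Circle × ℂ} (h : ‖w.2‖ = 1) :
    radialProjection w = w := by
  have : w.2 ≠ 0 := by rw [← norm_ne_zero_iff, h]; exact one_ne_zero
  simp [radialProjection, this, h]

theorem continuousOn_radialProjection : ContinuousOn radialProjection {w | w.2 ≠ 0} := by
  have : ContinuousOn (fun w : Circle × ℂ ↦ (w.1, ‖w.2‖⁻¹ • w.2)) {w | w.2 ≠ 0} :=
    continuousOn_fst.prodMk ((continuousOn_snd.norm.inv₀ fun w hw ↦ norm_ne_zero_iff.2 hw).smul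
      continuousOn_snd)
  refine this.congr fun w hw ↦ ?_
  simp only [mem_ofPred_eq] at hw
  simp [radialProjection, hw]

/-! ### Topology of the link exterior and its boundary -/

namespace IsLinkWithTubes

variable {c : ℕ} {K V : Fin c → Set S3} (hKV : IsLinkWithTubes K V)
include hKV

theorem isOpen_tube (i : Fin c) : IsOpen (V i) := by
  obtain ⟨φ, hφ, -, hV⟩ := hKV.tubular i
  exact hV ▸ isOpen_image_univ_prod_ball hφ

theorem core_subset_tube (i : Fin c) : K i ⊆ V i := by
  obtain ⟨φ, hφ, hK, hV⟩ := hKV.tubular i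
  rw [← hK, ← hV]
  exact image_mono (prod_mono_right (by simp))

theorem isClosed_core (i : Fin c) : IsClosed (K i) := by
  obtain ⟨φ, hφ, hK, hV⟩ := hKV.tubular i
  rw [← hK]
  exact ((isCompact_univ.prod isCompact_singleton).image hφ.continuous).isClosed

theorem eq_of_mem_closure {i j : Fin c} {b : S3} (hi : b ∈ closure (V i))
    (hj : b ∈ closure (V j)) : i = j := by
  by_contra h
  exact disjoint_left.1 (hKV.separated i j h) hi hj

theorem frontier_subset (i : Fin c) : frontier (V i) ⊆ (⋃ i, V i)ᶜ := by
  intro b hb hb'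
  obtain ⟨j, hj⟩ := mem_iUnion.1 hb'
  rw [(hKV.isOpen_tube i).frontier_eq] at hb
  obtain rfl := hKV.eq_of_mem_closure hb.1 (subset_closure hj)
  exact hb.2 hj

theorem isOpen_compl_cores : IsOpen (⋃ i, K i)ᶜ :=
  (isClosed_iUnion_of_finite hKV.isClosed_core).isOpen_compl

theorem exterior_subset_compl_cores : (⋃ i, V i)ᶜ ⊆ (⋃ i, K i)ᶜ :=
  compl_subset_compl.2 (iUnion_mono hKV.core_subset_tube)

/-- The complement of a link retracts onto the closed complement of the tubes. The retraction is
extended to the link in such a way that it maps each tube to its boundary. -/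
theorem exists_retraction : ∃ ρ : S3 → LinkExterior V, ContinuousOn ρ (⋃ i, K i)ᶜ ∧
    (∀ x : LinkExterior V, ρ x = x) ∧ ∀ i, ∀ b ∈ V i, ρ b ∈ boundaryTorus V i := by
  classical
  choose φ hφ hφK hφV using hKV.tubular
  have hfr (i : Fin c) : frontier (V i) = φ i '' (univ ×ˢ sphere 0 1) := by
    rw [← hφV, frontier_image_univ_prod_ball (hφ i)]
  have hcl (i : Fin c) : closure (V i) = φ i '' (univ ×ˢ closedBall 0 1) := by
    rw [← hφV, closure_image_univ_prod_ball (hφ i)]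
  let ψ (i : Fin c) := (hφ i).toOpenPartialHomeomorph (φ i)
  have hψφ (i : Fin c) (w : Circle × ℂ) : (ψ i).symm (φ i w) = w :=
    (ψ i).left_inv (by simp [ψ])
  let r (i : Fin c) (b : S3) : S3 := φ i (radialProjection ((ψ i).symm b))
  have hr (i : Fin c) (b : S3) : r i b ∈ frontier (V i) := by
    rw [hfr]
    exact mem_image_of_mem _ ⟨mem_univ _, by simp [norm_radialProjection_snd]⟩
  have hrfr (i : Fin c) (b : S3) (hb : b ∈ frontier (V i)) : r i b = b := by
    rw [hfr] at hb
    obtain ⟨w, ⟨-, hw⟩, rfl⟩ := hb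
    simp only [r]
    rw [hψφ, radialProjection_of_norm_eq_one (by simpa using hw)]
  have hrc (i : Fin c) : ContinuousOn (r i) (closure (V i) \ K i) := by
    refine (hφ i).continuous.comp_continuousOn (continuousOn_radialProjection.comp
      ((ψ i).continuousOn_symm.mono ?_) ?_)
    · rw [hcl]
      rintro _ ⟨⟨w, -, rfl⟩, -⟩
      exact (ψ i).map_source (by simp [ψ])
    · rw [hcl]
      rintro _ ⟨⟨w, -, rfl⟩, hw⟩
      rw [mem_ofPred_eq, hψφ]
      intro h
      refine hw ?_
      rw [← hφK]
      exact mem_image_of_mem _ ⟨mem_univ _, h⟩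
  let ρ (b : S3) : S3 := if h : ∃ i, b ∈ V i then r h.choose b else b
  have hρV (i : Fin c) (b : S3) (hb : b ∈ V i) : ρ b = r i b := by
    have h : ∃ i, b ∈ V i := ⟨i, hb⟩
    have : h.choose = i :=
      hKV.eq_of_mem_closure (subset_closure h.choose_spec) (subset_closure hb)
    simp only [ρ, dif_pos h, this]
  have hρX (b : S3) (hb : b ∈ (⋃ i, V i)ᶜ) : ρ b = b := by
    have h : ¬ ∃ i, b ∈ V i := by simpa using hb
    simp only [ρ, dif_neg h]
  have hρcl (i : Fin c) (b : S3) (hb : b ∈ closure (V i)) : ρ b = r i b := by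
    by_cases h : b ∈ V i
    · exact hρV i b h
    · have h' : b ∈ frontier (V i) := by
        rw [(hKV.isOpen_tube i).frontier_eq]; exact ⟨hb, h⟩
      rw [hρX b (hKV.frontier_subset i h'), hrfr i b h']
  have hρmem (b : S3) : ρ b ∈ (⋃ i, V i)ᶜ := by
    by_cases h : ∃ i, b ∈ V i
    · obtain ⟨i, hi⟩ := h
      rw [hρV i b hi]
      exact hKV.frontier_subset i (hr i b)
    · have h' : b ∈ (⋃ i, V i)ᶜ := by simpa using h
      rwa [hρX b h']
  refine ⟨fun b ↦ ⟨ρ b, hρmem b⟩, ?_, fun x ↦ Subtype.ext (hρX x x.2), fun i b hb ↦ ?_⟩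
  · rw [IsInducing.subtypeVal.continuousOn_iff]
    change ContinuousOn ρ _
    -- Continuity is pasted along a finite closed cover: the exterior and the closed tubes, where ρ
    -- is the identity and the radial projection respectively.
    let Z : Option (Fin c) → Set S3 := fun o ↦ o.elim (⋃ i, V i)ᶜ fun i ↦ closure (V i)
    have hZ (o : Option (Fin c)) : IsClosed (Z o) := by
      cases o with
      | none => exact (isOpen_iUnion hKV.isOpen_tube).isClosed_compl
      | some i => exact isClosed_closure
    have hcov : (⋃ i, K i)ᶜ ⊆ ⋃ o, Z o ∩ (⋃ i, K i)ᶜ := by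
      intro b hb
      by_cases h : ∃ i, b ∈ V i
      · obtain ⟨i, hi⟩ := h
        exact mem_iUnion.2 ⟨some i, subset_closure hi, hb⟩
      · exact mem_iUnion.2 ⟨none, by simpa [Z] using h, hb⟩
    have hon (o : Option (Fin c)) : ContinuousOn ρ (Z o ∩ (⋃ i, K i)ᶜ) := by
      cases o with
      | none => exact continuousOn_id.congr fun b hb ↦ hρX b hb.1
      | some i =>
        exact ((hrc i).mono fun b hb ↦ ⟨hb.1, fun h ↦ hb.2 (mem_iUnion.2 ⟨i, h⟩)⟩).congr
          fun b hb ↦ hρcl i b hb.1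
    intro b hb
    refine ContinuousWithinAt.mono ?_ hcov
    rw [ContinuousWithinAt, nhdsWithin_iUnion, Filter.tendsto_iSup]
    intro o
    by_cases hbo : b ∈ Z o
    · exact hon o b ⟨hbo, hb⟩
    · have : 𝓝[Z o ∩ (⋃ i, K i)ᶜ] b = ⊥ := by
        rw [← notMem_closure_iff_nhdsWithin_eq_bot]
        exact fun h ↦ hbo ((hZ o).closure_subset (closure_mono inter_subset_left h))
      rw [this]
      exact Filter.tendsto_bot
  · change ρ b ∈ frontier (V i)
    rw [hρV i b hb]
    exact hr i b

/-- A continuous surjection is enough: path connectedness passes to the image, and compactness makes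
the map a quotient map, so local path connectedness passes too. -/
theorem exists_surjective_torus (i : Fin c) :
    ∃ h : Circle × sphere (0 : ℂ) 1 → boundaryTorus V i,
      Continuous h ∧ Function.Surjective h := by
  obtain ⟨φ, hφ, hK, hV⟩ := hKV.tubular i
  have hfr : frontier (V i) = φ '' (univ ×ˢ sphere 0 1) := by
    rw [← hV, frontier_image_univ_prod_ball hφ]
  have hmem (w : Circle × sphere (0 : ℂ) 1) : φ (w.1, w.2) ∈ frontier (V i) := by
    rw [hfr]
    exact mem_image_of_mem _ ⟨mem_univ _, w.2.2⟩
  refine ⟨fun w ↦ ⟨⟨φ (w.1, w.2), hKV.frontier_subset i (hmem w)⟩, hmem w⟩, ?_, ?_⟩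
  · refine Continuous.subtype_mk (Continuous.subtype_mk (hφ.continuous.comp ?_) _) _
    fun_prop
  · rintro ⟨⟨b, hbX⟩, hb⟩
    have hb' : b ∈ frontier (V i) := hb
    rw [hfr] at hb'
    obtain ⟨⟨a, z⟩, ⟨-, hz⟩, rfl⟩ := hb'
    exact ⟨⟨a, z, hz⟩, rfl⟩

theorem pathConnectedSpace_boundaryTorus (i : Fin c) : PathConnectedSpace (boundaryTorus V i) := by
  obtain ⟨h, hc, hs⟩ := hKV.exists_surjective_torus i
  have : PathConnectedSpace (sphere (0 : ℂ) 1) := isPathConnected_iff_pathConnectedSpace.1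
    (isPathConnected_sphere (by simp) 0 zero_le_one)
  have : PathConnectedSpace Circle := this
  exact hs.pathConnectedSpace hc

theorem locallyPathConnectedSpace_boundaryTorus (i : Fin c) :
    LocallyPathConnectedSpace (boundaryTorus V i) := by
  obtain ⟨h, hc, hs⟩ := hKV.exists_surjective_torus i
  have : LocallyPathConnectedSpace Circle :=
    ChartedSpace.locallyPathConnectedSpace (EuclideanSpace ℝ (Fin 1)) _
  have : LocallyPathConnectedSpace (sphere (0 : ℂ) 1) := ‹LocallyPathConnectedSpace Circle›
  exact (hc.isClosedMap.isQuotientMap hc hs).locallyPathConnectedSpace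

/-- Local path connectedness comes from the retraction, which is a quotient map from an open subset
of S³. Connectedness comes from that of S³, by extending locally constant functions over the tubes.
-/
theorem pathConnectedSpace_linkExterior (x : LinkExterior V) :
    PathConnectedSpace (LinkExterior V) := by
  obtain ⟨ρ, hρ, hρX, hρV⟩ := hKV.exists_retraction
  have hfact : Fact (Module.finrank ℝ (EuclideanSpace ℝ (Fin 4)) = 3 + 1) := ⟨by simp⟩
  have : LocallyPathConnectedSpace S3 :=
    ChartedSpace.locallyPathConnectedSpace (EuclideanSpace ℝ (Fin 3)) _
  have : LocallyPathConnectedSpace ((⋃ i, K i)ᶜ : Set S3) :=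
    hKV.isOpen_compl_cores.locallyPathConnectedSpace
  have hq : IsQuotientMap (fun b : ((⋃ i, K i)ᶜ : Set S3) ↦ ρ b) :=
    IsQuotientMap.of_inverse (continuous_inclusion hKV.exterior_subset_compl_cores)
      (continuousOn_iff_continuous_domRestrict.1 hρ) hρX
  have := hq.locallyPathConnectedSpace
  have hS : PreconnectedSpace S3 := isPreconnected_iff_preconnectedSpace.1
    (isPreconnected_sphere (by
      rw [← Module.finrank_eq_rank]; simp) 0 1)
  have : PreconnectedSpace (LinkExterior V) := by
    refine preconnectedSpace_of_forall_constant fun f hf x y ↦ ?_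
    -- Although ρ need not be continuous at the cores, it maps each tube into a connected torus, on
    -- which f is constant.
    have hg : Continuous (f ∘ ρ) := by
      rw [continuous_iff_continuousAt]
      intro b
      by_cases hb : b ∈ ⋃ i, K i
      · obtain ⟨i, hi⟩ := mem_iUnion.1 hb
        have hbV := hKV.core_subset_tube i hi
        have := hKV.pathConnectedSpace_boundaryTorus i
        refine (continuousAt_const (y := f (ρ b))).congr ?_
        filter_upwards [(hKV.isOpen_tube i).mem_nhds hbV] with b' hb'
        exact PreconnectedSpace.constant (f := fun t : boundaryTorus V i ↦ f t) inferInstance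
          (hf.comp continuous_subtype_val) (x := ⟨_, hρV i b hbV⟩) (y := ⟨_, hρV i b' hb'⟩)
      · exact hf.continuousAt.comp (hρ.continuousAt (hKV.isOpen_compl_cores.mem_nhds hb))
    have := PreconnectedSpace.constant hS hg (x := (x : S3)) (y := (y : S3))
    simpa [hρX] using this
  have : ConnectedSpace (LinkExterior V) := { toNonempty := ⟨x⟩ }
  exact PathConnectedSpace.of_locallyPathConnectedSpace

end IsLinkWithTubes

/-! ### Extending the covering over the tubes, and the conclusion -/

/-- If the preimage of each boundary torus of a covering of a link exterior has as many path
components as the covering has sheets, then the covering has a global continuous section through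
every point. -/
theorem IsLinkWithTubes.exists_section_of_natCard_zerothHomotopy {c : ℕ} {K V : Fin c → Set S3}
    (hKV : IsLinkWithTubes K V) {Y : Type*} [TopologicalSpace Y] {p : Y → LinkExterior V}
    (cov : IsCoveringMap p) {n : ℕ} (hn : n ≠ 0) (hfib : ∀ x, Nat.card (p ⁻¹' {x}) = n)
    (hcomp : ∀ i, Nat.card (ZerothHomotopy ↥(p ⁻¹' boundaryTorus V i)) = n) (y : Y) :
    ∃ s : LinkExterior V → Y, Continuous s ∧ (∀ x, p (s x) = x) ∧ s (p y) = y := by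
  classical
  obtain ⟨ρ, hρ, hρX, hρV⟩ := hKV.exists_retraction
  have hloc (x : LinkExterior V) := cov.exists_local_sections hn x (hfib x)
  choose D s hDo hD hsc hps hsu using hloc
  have htor (i : Fin c) : ∃ s : Fin n → LinkExterior V → Y,
      (∀ f, ContinuousOn (s f) (boundaryTorus V i)) ∧
      (∀ f, ∀ x ∈ boundaryTorus V i, p (s f x) = x) ∧
      ∀ y, p y ∈ boundaryTorus V i → ∃! f, s f (p y) = y := by
    have := hKV.pathConnectedSpace_boundaryTorus i
    have := hKV.locallyPathConnectedSpace_boundaryTorus i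
    have hfib' (t : boundaryTorus V i) :
        Nat.card ((boundaryTorus V i).restrictPreimage p ⁻¹' {t}) = n := by
      rw [← hfib t]
      refine Nat.card_congr ⟨fun z ↦ ⟨z.1, congrArg Subtype.val z.2⟩,
        fun z ↦ ⟨⟨z.1, ?_⟩, Subtype.ext z.2⟩, fun _ ↦ rfl, fun _ ↦ rfl⟩
      have hz : p z.1 = t := z.2
      rw [mem_preimage, hz]
      exact t.2
    obtain ⟨σ, hσ, hpσ, hσu⟩ := (cov.restrictPreimage
      (boundaryTorus V i)).exists_sections_of_natCard_zerothHomotopy hn hfib' (hcomp i)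
    have : Finite (ZerothHomotopy ↥(p ⁻¹' boundaryTorus V i)) :=
      Nat.finite_of_card_ne_zero (by rw [hcomp]; exact hn)
    let e : Fin n ≃ ZerothHomotopy ↥(p ⁻¹' boundaryTorus V i) :=
      (Finite.equivFinOfCardEq (hcomp i)).symm
    refine ⟨fun f x ↦ if h : x ∈ boundaryTorus V i then (σ (e f) ⟨x, h⟩).1 else y,
      fun f ↦ ?_, fun f x hx ↦ ?_, fun y hy ↦ ?_⟩
    · rw [continuousOn_iff_continuous_domRestrict]
      refine (continuous_subtype_val.comp (hσ (e f))).congr fun t ↦ ?_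
      simp [domRestrict]
    · simp only [hx, dif_pos]
      exact congrArg Subtype.val (hpσ (e f) ⟨x, hx⟩)
    · simp only [hy, dif_pos]
      obtain ⟨C, hC, hCu⟩ := hσu ⟨y, hy⟩
      refine ⟨e.symm C, ?_, fun f hf ↦ ?_⟩
      · dsimp only
        rw [e.apply_symm_apply]
        exact congrArg Subtype.val hC
      · rw [e.eq_symm_apply]
        exact hCu _ (Subtype.ext hf)
  choose σ hσc hpσ hσu using htor
  let W : Set S3 := (⋃ i, K i)ᶜ
  have hWo : IsOpen W := hKV.isOpen_compl_cores
  -- Charts of the first kind pull back evenly covered open sets of X; those of the second kind are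
  -- whole tubes, labelled by the sections over their boundary tori, and include the cores where ρ
  -- is uncontrolled.
  let T : SectionAtlas p ρ W (Fin n) (LinkExterior V ⊕ Fin c) :=
    { D := Sum.elim D (boundaryTorus V)
      sec := Sum.elim s σ
      A := Sum.elim (fun x ↦ W ∩ ρ ⁻¹' D x) V
      at' := fun b ↦ if h : ∃ i, b ∈ V i then .inr h.choose else .inl (ρ b)
      mem_at := fun b ↦ by
        split_ifs with h
        · exact h.choose_spec
        · exact ⟨hKV.exterior_subset_compl_cores (by simpa using h), hD _⟩
      isOpen_A := by
        rintro (x | i)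
        · exact hρ.isOpen_inter_preimage hWo (hDo x)
        · exact hKV.isOpen_tube i
      continuousOn_ρ := hρ
      continuousOn_sec := by
        rintro (x | i)
        exacts [hsc x, hσc i]
      proj_sec := by
        rintro (x | i)
        exacts [hps x, hpσ i]
      existsUnique := by
        rintro (x | i)
        exacts [hsu x, hσu i]
      mapsTo := by
        rintro (x | i) b hb
        exacts [hb.1.2, hρV i b hb.1]
      inter_subset := by
        rintro (x | i) (x' | j) hne b hb
        · exact hb.1.1
        · exact hb.1.1
        · exact hb.2.1
        · exact absurd (hKV.eq_of_mem_closure (subset_closure hb.1) (subset_closure hb.2))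
            fun h ↦ hne (congrArg _ h) }
  have : Nonempty (Fin n) := ⟨⟨0, Nat.pos_of_ne_zero hn⟩⟩
  exact T.exists_section cov
    (IsCoveringMap.exists_section_sphere (FiberBundle.isCoveringMap (F := Fin n)))
    continuous_subtype_val hρX (fun x ↦ hKV.exterior_subset_compl_cores x.2) y

theorem IsCoveringMap.pathConnectedSpace_preimage_of_bijective {E X : Type*} [TopologicalSpace E]
    [TopologicalSpace X] {p : E → X} (cov : IsCoveringMap p) (hp : Function.Bijective p)
    (T : Set X) [PathConnectedSpace T] : PathConnectedSpace ↥(p ⁻¹' T) := by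
  let h : E ≃ₜ X := (Equiv.ofBijective p hp).toHomeomorphOfContinuousOpen cov.continuous
    cov.isOpenMap
  have hT : IsPathConnected T := isPathConnected_iff_pathConnectedSpace.2 inferInstance
  have := hT.image h.symm.continuous
  rw [h.image_symm] at this
  exact isPathConnected_iff_pathConnectedSpace.1 this

theorem mainTheorem11 {c : ℕ} (K V : Fin c → Set S3) (hKV : IsLinkWithTubes K V)
    (hK : IsPeripherallyNontrivial V) (x : LinkExterior V)
    (U : Subgroup (LinkGroup V x)) [U.Normal] [U.FiniteIndex]
    {Y : Type*} [TopologicalSpace Y] (p : C(Y, LinkExterior V)) (hp : IsCoveringInducedBy U p) :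
    U = ⊤ ↔ ∀ i : Fin c,
      Nat.card (ZerothHomotopy ↥(p ⁻¹' boundaryTorus V i)) = U.index := by
  obtain ⟨hY, cov, y, hy, hU⟩ := hp
  have := hKV.pathConnectedSpace_linkExterior x
  have hfib (x' : LinkExterior V) : Nat.card (p ⁻¹' {x'}) = U.index := by
    rw [cov.natCard_fiber_eq x' x, cov.natCard_fiber_eq_index p hy, hU]
  constructor
  · intro htop i
    have hone : U.index = 1 := by rw [htop, Subgroup.index_top]
    have hbij : Function.Bijective p := by
      refine ⟨fun e e' h ↦ ?_, fun x' ↦ ?_⟩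
      · have := (Nat.card_eq_one_iff_unique.1 ((hfib (p e')).trans hone)).1
        exact congrArg Subtype.val
          (Subsingleton.elim (⟨e, h⟩ : p ⁻¹' {p e'}) ⟨e', rfl⟩)
      · obtain ⟨e⟩ := (Nat.card_eq_one_iff_unique.1 ((hfib x').trans hone)).2
        exact ⟨e.1, e.2⟩
    have := hKV.pathConnectedSpace_boundaryTorus i
    have := cov.pathConnectedSpace_preimage_of_bijective hbij (boundaryTorus V i)
    obtain ⟨hne, hsub⟩ := pathConnectedSpace_iff_zerothHomotopy.1 this
    rw [hone]
    exact Nat.card_eq_one_iff_unique.2 ⟨hsub, hne⟩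
  · intro hcomp
    have hinj := cov.injective_of_exists_section fun e ↦
      hKV.exists_section_of_natCard_zerothHomotopy cov Subgroup.FiniteIndex.index_ne_zero
        hfib hcomp e
    rw [← Subgroup.index_eq_one, ← hfib x]
    refine Nat.card_eq_one_iff_unique.2 ⟨⟨fun e e' ↦ Subtype.ext (hinj ?_)⟩, ⟨⟨y, hy⟩⟩⟩
    exact e.2.trans e'.2.symm
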